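/- **Theorem (Inner Region).** Let $n\ge 2$ be an integer and, for functions of $r$ (or of $\sigma$), let $$\mathcal F[v]= v\,v_{rr}-\tfrac12 v_r^2+\frac{n-1-v}{r}\,v_r+\frac{2(n-1)}{r^2}\,v(1-v),$$ with first variation $d\mathcal F_V[W]=\frac{d}{ds}\big|_{s=0}\mathcal F[V+sW]$. Let $\mathfrak B:(0,\infty)\to(0,1)$ be the normalized profile of the Bryant steady soliton on $\mathbb R^{n+1}$, i.e. the solution of $\mathcal F[\mathfrak B]=0$ with $\mathfrak B(\sigma)\to1$ as $\sigma\searrow0$ and $\mathfrak B(\sigma)=\sigma^{-2}+o(\sigma^{-2})$ as $\sigma\to\infty$. Let $\mathfrak C:(0,\infty)\to(0,\infty)$ be any strictly positive solution of $d\mathcal F_{\mathfrak B}[\mathfrak C]=-\sigma\mathfrak B'(\sigma)$ that is bounded near $\sigma=0$. For $0<t<1$ put $$\theta=\theta(t)=\sqrt{\frac{t}{-\log t}},\qquad \sigma=\frac r{\theta(t)},\qquad \theta_t=\frac{d\theta}{dt}.$$ Then for all $\varepsilon>0$ and $B>0$ there exists $t_*\in(0,1)$, depending only on $n$, $\varepsilon$,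 $B$ and the choice of $\mathfrak C$, such that for every $k\in\bigl[\frac1{2(n-1)},\frac2{n-1}\bigr]$ the functions $$v_{\rm in}^{\pm}(r,t)=\mathfrak B(k\sigma)+(1\mp\varepsilon)\,\theta\theta_t\,k^{-2}\,\mathfrak C(k\sigma)$$ are a smooth subsolution ($v_{\rm in}^-$, i.e. $v_t\le\mathcal F[v]$) and a smooth supersolution ($v_{\rm in}^+$, i.e. $v_t\ge\mathcal F[v]$) of $v_t=\mathcal F[v]$ in the region $$\Omega_{\rm in}=\Bigl\{(r,t):\ 0<r\le \frac{3B}{\sqrt\varepsilon}\sqrt{\frac t{-\log t}},\quad 0<t<t_*\Bigr\}.$$ -/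

import Mathlib

open Set Filter Topology
open scoped ContDiff

noncomputable section

namespace RicciNeckpinch

/-- The differential operator
`𝓕[v] = v v'' - (v')² / 2 + (n - 1 - v) v' / r + 2 (n - 1) v (1 - v) / r²`,
acting on functions of one variable and evaluated at `r`. -/
def opF (n : ℕ) (v : ℝ → ℝ) (r : ℝ) : ℝ :=
  v r * deriv (deriv v) r - (1 / 2) * (deriv v r) ^ 2
    + ((n : ℝ) - 1 - v r) / r * deriv v r
    + 2 * ((n : ℝ) - 1) / r ^ 2 * (v r * (1 - v r))

/-- The first variation `d𝓕_V[W] = (d/ds) 𝓕[V + s W]` at `s = 0`, evaluated at `σ`. -/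
def dOpF (n : ℕ) (V W : ℝ → ℝ) (σ : ℝ) : ℝ :=
  deriv (fun s : ℝ => opF n (fun x => V x + s * W x) σ) 0

/-- `𝔅` is, on `(0, ∞)`, the normalized profile of the Bryant steady soliton on `ℝ^{n+1}`:
a solution of `𝓕[𝔅] = 0` with values in `(0, 1)` for which the metric
`(dσ)² / 𝔅(σ) + σ² g_can` closes up at the origin (that is, `𝔅(0+) = 1`; completeness at
infinity is automatic since `𝔅 < 1`), scaled so that `𝔅(σ) = σ⁻² + o(σ⁻²)` at infinity. -/
structure IsBryantProfile (n : ℕ) (𝔅 : ℝ → ℝ) : Prop where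
  contDiffOn : ContDiffOn ℝ 2 𝔅 (Ioi 0)
  ode : ∀ σ : ℝ, 0 < σ → opF n 𝔅 σ = 0
  pos : ∀ σ : ℝ, 0 < σ → 0 < 𝔅 σ
  lt_one : ∀ σ : ℝ, 0 < σ → 𝔅 σ < 1
  tendsto_zero : Tendsto 𝔅 (𝓝[>] 0) (𝓝 1)
  tendsto_atTop : Tendsto (fun σ : ℝ => σ ^ 2 * 𝔅 σ) atTop (𝓝 1)

/-- `ℭ` is a strictly positive solution on `(0, ∞)` of `d𝓕_𝔅[ℭ] = -σ 𝔅'(σ)` which is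
bounded near `σ = 0`. -/
structure IsBryantCorrection (n : ℕ) (𝔅 ℭ : ℝ → ℝ) : Prop where
  contDiffOn : ContDiffOn ℝ 2 ℭ (Ioi 0)
  ode : ∀ σ : ℝ, 0 < σ → dOpF n 𝔅 ℭ σ = -σ * deriv 𝔅 σ
  pos : ∀ σ : ℝ, 0 < σ → 0 < ℭ σ
  bounded_zero : ∃ M δ : ℝ, 0 < δ ∧ ∀ σ : ℝ, 0 < σ → σ < δ → ℭ σ ≤ M

/-- The inner length scale `θ(t) = √(t / (-log t))`, meaningful for `0 < t < 1`. -/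
def theta (t : ℝ) : ℝ := Real.sqrt (t / (-Real.log t))

/-- `v(r, t) = 𝔅(k σ) + c θ θ_t k⁻² ℭ(k σ)` with `σ = r / θ(t)`. -/
def innerBarrier (𝔅 ℭ : ℝ → ℝ) (k c : ℝ) (r t : ℝ) : ℝ :=
  𝔅 (k * (r / theta t)) + c * (theta t * deriv theta t) * (k ^ 2)⁻¹ * ℭ (k * (r / theta t))

/-- The inner region: `0 < r ≤ 3 B ε^{-1/2} √(t / (-log t))` and `0 < t < tstar`. -/
def innerRegion (B ε tstar : ℝ) : Set (ℝ × ℝ) :=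
  {p | (0 < p.1 ∧ p.1 ≤ 3 * (B / Real.sqrt ε) * Real.sqrt (p.2 / (-Real.log p.2))) ∧
    0 < p.2 ∧ p.2 < tstar}

/-- `v(r, t)` is a smooth subsolution of `v_t = 𝓕[v]` on `Ω`. -/
def IsSubsolutionOn (n : ℕ) (v : ℝ → ℝ → ℝ) (Ω : Set (ℝ × ℝ)) : Prop :=
  ∀ r t : ℝ, (r, t) ∈ Ω →
    ContDiffAt ℝ ∞ (fun p : ℝ × ℝ => v p.1 p.2) (r, t) ∧
      deriv (fun s => v r s) t ≤ opF n (fun x => v x t) r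

/-- `v(r, t)` is a smooth supersolution of `v_t = 𝓕[v]` on `Ω`. -/
def IsSupersolutionOn (n : ℕ) (v : ℝ → ℝ → ℝ) (Ω : Set (ℝ × ℝ)) : Prop :=
  ∀ r t : ℝ, (r, t) ∈ Ω →
    ContDiffAt ℝ ∞ (fun p : ℝ × ℝ => v p.1 p.2) (r, t) ∧
      opF n (fun x => v x t) r ≤ deriv (fun s => v r s) t

end RicciNeckpinch

end

/-! Write `P = -x 𝔅'(x)` with `x = kσ`, and `L = -log t`. Since `𝓕` is a quadratic polynomial in the
function and its derivatives, `𝓕[v]` expands exactly about the profile. The zeroth order vanishes.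
The linear order gives `c (θ_t/θ) P` by the equation for `ℭ`, the factor `k⁻²` cancelling the `k²`
produced by scaling. The time derivative of `𝔅(kσ)` gives `(θ_t/θ) P`. Hence `v_t - 𝓕[v] =
(θ_t/θ)((1 - c) P + error)`. With `c = 1 ± ε` the main term is `∓ε P`, so it is enough that `P > 0`
and that the error is `O(P/L)`.

The difficulty is that `P` vanishes as `x → 0`, like `x²`, so `ℭ`, `xℭ'` and the quadratic term must
be bounded by `P` there, although `ℭ` is only assumed bounded. In `s = log x` the profile equation
is autonomous, so `p = P` solves the homogeneous linearized equation. The Wronskian `W = p c' - q c`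
of `p` with the correction `c` then obeys a first-order equation, and `(c/p)' = W/p²`. Boundedness
of `c` excludes `W < 0` (`wronskian_nonneg`), and positivity of `c` bounds `W/p²` above
(`wronskian_le`). So `c/p` is monotone, which controls `c`, then `c'` and `c''`. The estimate
returns to `x` in `IsBryantCorrection.exists_bound` and enters the defect in `abs_defect_le`. -/

namespace RicciNeckpinch

/-! ### Backward monotonicity on half-lines. -/

/-- A function that is nonincreasing wherever it is positive, and is positive at `b`, is at least
`f b` to the left of `b`. -/
theorem le_of_deriv_nonpos_of_pos {f f' : ℝ → ℝ} {b : ℝ}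
    (hf : ∀ s ≤ b, HasDerivAt f (f' s) s) (hf' : ∀ s ≤ b, 0 < f s → f' s ≤ 0) (hb : 0 < f b)
    {a : ℝ} (hab : a ≤ b) : f b ≤ f a := by
  by_contra! hlt
  -- The level is at least `f a`, so it is attained or undercut on `[a, b]`, and it is positive, so
  -- the sign condition applies above it. After the last point `c` with `f c ≤ l`, `f` is
  -- nonincreasing and cannot climb to `f b > l`.
  set l := max (f a) (f b / 2) with hl
  have hlb : l < f b := max_lt hlt (by linarith)
  have hl0 : 0 < l := lt_of_lt_of_le (by linarith) (le_max_right _ _)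
  have hcont : ContinuousOn f (Icc a b) := fun s hs => (hf s hs.2).continuousAt.continuousWithinAt
  have hcl : IsClosed (Icc a b ∩ f ⁻¹' Iic l) := hcont.preimage_isClosed_of_isClosed isClosed_Icc isClosed_Iic
  have hcpt : IsCompact (Icc a b ∩ f ⁻¹' Iic l) :=
    isCompact_Icc.of_isClosed_subset hcl inter_subset_left
  obtain ⟨c, hc, hmax⟩ := hcpt.exists_isGreatest ⟨a, ⟨le_rfl, hab⟩, show f a ≤ l from le_max_left _ _⟩
  have hanti : AntitoneOn f (Icc c b) := by
    refine antitoneOn_of_hasDerivWithinAt_nonpos (f' := f') (convex_Icc c b)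
      (hcont.mono (Icc_subset_Icc_left hc.1.1)) ?_ ?_
    · intro s hs
      rw [interior_Icc] at hs ⊢
      exact (hf s hs.2.le).hasDerivWithinAt
    · intro s hs
      rw [interior_Icc] at hs
      refine hf' s hs.2.le ?_
      by_contra! h
      exact absurd (hmax ⟨⟨hc.1.1.trans hs.1.le, hs.2.le⟩, h.trans hl0.le⟩) (not_le.2 hs.1)
  have h1 := hanti ⟨le_rfl, hc.1.2⟩ ⟨hc.1.2, le_rfl⟩ hc.1.2
  have h2 : f c ≤ l := hc.2
  linarith

theorem antitoneOn_Iic_of_hasDerivAt {f f' : ℝ → ℝ} {b : ℝ}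
    (hf : ∀ s ≤ b, HasDerivAt f (f' s) s) (hf' : ∀ s ≤ b, f' s ≤ 0) : AntitoneOn f (Iic b) := by
  refine antitoneOn_of_hasDerivWithinAt_nonpos (f' := f') (convex_Iic b)
    (fun s hs => (hf s hs).continuousAt.continuousWithinAt) ?_ ?_
  · intro s hs
    rw [interior_Iic] at hs ⊢
    exact (hf s (le_of_lt hs)).hasDerivWithinAt
  · intro s hs
    rw [interior_Iic] at hs
    exact hf' s (le_of_lt hs)

/-! ### The Bryant profile in the logarithmic variable. -/

/-- The profile equation for `w = 1 - 𝔅` in the logarithmic variable `s = log σ`, with `N = n - 1`,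
`p = w_s` and `q = w_ss`. -/
structure IsLogProfile (N : ℝ) (w p q : ℝ → ℝ) : Prop where
  one_le : 1 ≤ N
  deriv_w : ∀ s, HasDerivAt w (p s) s
  deriv_p : ∀ s, HasDerivAt p (q s) s
  ode : ∀ s, (1 - w s) * q s + (1 / 2) * p s ^ 2 + (N - 2 + 2 * w s) * p s
    - 2 * N * (w s * (1 - w s)) = 0
  pos : ∀ s, 0 < w s
  lt_one : ∀ s, w s < 1
  tendsto : Tendsto w atBot (𝓝 0)

namespace IsLogProfile

variable {N : ℝ} {w p q : ℝ → ℝ}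

/-- As `w` starts from `0` at `-∞`, a negative slope forces an earlier interior maximum. At a
critical point the equation gives `(1 - w) q = 2N w (1 - w) > 0`, which makes it a strict minimum.
-/
theorem deriv_ne_neg (h : IsLogProfile N w p q) (b : ℝ) : ¬ p b < 0 := by
  intro hb
  have hN := h.one_le
  obtain ⟨a, haw, hab⟩ :=
    ((h.tendsto.eventually_lt_const (h.pos b)).and (eventually_lt_atBot b)).exists
  have hcont : Continuous w := continuous_iff_continuousAt.2 fun s => (h.deriv_w s).continuousAt
  obtain ⟨c, hc, hmax⟩ := isCompact_Icc.exists_isMaxOn (nonempty_Icc.2 hab.le) hcont.continuousOn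
  have hca : c ≠ a := by
    rintro rfl
    have : w b ≤ w c := hmax ⟨hab.le, le_rfl⟩
    linarith
  have hcb : c ≠ b := by
    rintro rfl
    have hev : ∀ᶠ s in 𝓝[<] c, w c < w s := by
      have := (h.deriv_w c).tendsto_slope
      have := (this.mono_left (nhdsLT_le_nhdsNE c)).eventually_lt_const hb
      filter_upwards [this, self_mem_nhdsWithin] with s hs hsc
      have hsc : s < c := hsc
      rw [slope_def_field, div_lt_iff_of_neg (by linarith)] at hs
      linarith
    have hev2 : ∀ᶠ s in 𝓝[<] c, a < s := nhdsWithin_le_nhds (lt_mem_nhds hab)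
    obtain ⟨s, ⟨h1, h2⟩, h3⟩ := ((hev.and hev2).and self_mem_nhdsWithin).exists
    have : w s ≤ w c := hmax ⟨h2.le, le_of_lt h3⟩
    linarith
  have hlt1 : a < c := lt_of_le_of_ne hc.1 (Ne.symm hca)
  have hlt2 : c < b := lt_of_le_of_ne hc.2 hcb
  have hloc : IsLocalMax w c := hmax.isLocalMax (Icc_mem_nhds hlt1 hlt2)
  have hp0 : p c = 0 := hloc.hasDerivAt_eq_zero (h.deriv_w c)
  have hq : 0 < q c := by
    have := h.ode c
    rw [hp0] at this
    have h1 : 0 < 1 - w c := by linarith [h.lt_one c]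
    have h2 : 0 < 2 * N * (w c * (1 - w c)) := by have := h.pos c; positivity
    have h3 : 0 < (1 - w c) * q c := by linarith
    exact (pos_iff_pos_of_mul_pos h3).1 h1
  have hdw : deriv w = p := funext fun s => (h.deriv_w s).deriv
  have hmin : IsLocalMin w c := by
    refine isLocalMin_of_deriv_deriv_pos ?_ ?_ (h.deriv_w c).continuousAt
    · rw [hdw, (h.deriv_p c).deriv]; exact hq
    · rw [hdw, hp0]
  have hconst : w =ᶠ[𝓝 c] fun _ => w c := by
    filter_upwards [hloc, hmin] with s h1 h2 using le_antisymm h1 h2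
  have hp : p =ᶠ[𝓝 c] fun _ => 0 := by
    have := hconst.deriv
    rw [hdw] at this
    filter_upwards [this] with s hs
    simpa using hs
  have := hp.deriv_eq
  rw [(h.deriv_p c).deriv, deriv_const] at this
  linarith

theorem deriv_pos (h : IsLogProfile N w p q) (b : ℝ) : 0 < p b := by
  refine lt_of_le_of_ne (not_lt.1 (h.deriv_ne_neg b)) fun h0 => ?_
  have hN := h.one_le
  have hloc : IsLocalMin p b := Eventually.of_forall fun s => by
    rw [← h0]; exact not_lt.1 (h.deriv_ne_neg s)
  have hq := hloc.hasDerivAt_eq_zero (h.deriv_p b)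
  have := h.ode b
  rw [hq, ← h0] at this
  have h1 : 0 < 1 - w b := by linarith [h.lt_one b]
  have h2 : 0 < 2 * N * (w b * (1 - w b)) := by have := h.pos b; positivity
  linarith

/-- The excess `p - 2w` is nonincreasing where positive, so a positive value persists backwards.
Then `w` has slope bounded below by a positive constant on a half-line and must become negative. -/
theorem deriv_le (h : IsLogProfile N w p q) (b : ℝ) : p b ≤ 2 * w b := by
  by_contra! hb
  have hN := h.one_le
  have hu : ∀ s, HasDerivAt (fun s => p s - 2 * w s) (q s - 2 * p s) s := fun s =>
    (h.deriv_p s).sub ((h.deriv_w s).const_mul 2)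
  have hmono : ∀ a ≤ b, p b - 2 * w b ≤ p a - 2 * w a := fun a hab => by
    refine le_of_deriv_nonpos_of_pos (fun s _ => hu s) (fun s _ hs => ?_) (by linarith) hab
    have h1 : 0 < 1 - w s := by linarith [h.lt_one s]
    have hode := h.ode s
    have h3 : (1 - w s) * (q s - 2 * p s)
        = -(1 / 2 * p s ^ 2 + N * (p s - 2 * w s) + 2 * N * w s ^ 2) := by linear_combination hode
    have h4 : 0 ≤ 1 / 2 * p s ^ 2 + N * (p s - 2 * w s) + 2 * N * w s ^ 2 := by positivity
    by_contra! hc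
    have := mul_pos h1 hc
    linarith
  set m := p b - 2 * w b with hm
  have hm0 : 0 < m := by linarith
  have hanti := antitoneOn_Iic_of_hasDerivAt (b := b)
    (fun s _ => ((hasDerivAt_id s).const_mul m).sub (h.deriv_w s)) (fun s hs => by
      have := hmono s hs
      have := h.pos s
      linarith)
  have hle : b - w b / m ≤ b := by have := h.pos b; linarith [div_pos this hm0]
  have := hanti (mem_Iic.2 hle) (mem_Iic.2 le_rfl) hle
  have h5 := h.pos (b - w b / m)
  have h6 : m * (w b / m) = w b := by field_simp
  simp only [Pi.sub_apply, id, mul_sub, h6] at this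
  linarith

/-- A positive deficit would persist backwards, but it is at most `2w → 0`. The coefficient `4`
leaves a term `-2N w²` that absorbs `p²/2 ≤ 2w²`. -/
theorem le_deriv (h : IsLogProfile N w p q) (b : ℝ) : 2 * w b - 4 * w b ^ 2 ≤ p b := by
  by_contra! hb
  have hN := h.one_le
  have hu : ∀ s, HasDerivAt (fun s => 2 * w s - 4 * w s ^ 2 - p s)
      (2 * p s - 4 * (2 * w s * p s) - q s) s := fun s => by
    refine ((((h.deriv_w s).const_mul 2).sub (((h.deriv_w s).pow 2).const_mul 4)).sub
      (h.deriv_p s)).congr_deriv ?_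
    simp
  have hmono : ∀ a ≤ b, 2 * w b - 4 * w b ^ 2 - p b ≤ 2 * w a - 4 * w a ^ 2 - p a :=
    fun a hab => by
    refine le_of_deriv_nonpos_of_pos (fun s _ => hu s) (fun s _ hs => ?_) (by linarith) hab
    have h1 : 0 < 1 - w s := by linarith [h.lt_one s]
    have hode := h.ode s
    have hp := h.deriv_pos s
    have hw := h.pos s
    have hp2 : p s ^ 2 ≤ 4 * w s ^ 2 := by nlinarith [h.deriv_le s]
    have h3 : (1 - w s) * (2 * p s - 4 * (2 * w s * p s) - q s)
        = 1 / 2 * p s ^ 2 - N * (2 * w s - 4 * w s ^ 2 - p s) - 2 * N * w s ^ 2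
          - 8 * (w s * p s * (1 - w s)) := by linear_combination -hode
    have h4 : 0 < N * (2 * w s - 4 * w s ^ 2 - p s) := by positivity
    have h5 : 0 < w s * p s * (1 - w s) := by positivity
    have h6 : w s ^ 2 ≤ N * w s ^ 2 := le_mul_of_one_le_left (by positivity) hN
    by_contra! hc
    have := mul_pos h1 hc
    linarith
  obtain ⟨a, haw, hab⟩ := ((h.tendsto.eventually_lt_const
    (show 0 < (2 * w b - 4 * w b ^ 2 - p b) / 2 by linarith)).and (eventually_lt_atBot b)).exists
  have := hmono a hab.le
  have := h.deriv_pos a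
  nlinarith [sq_nonneg (w a)]

theorem hasDerivAt_exp_two (s : ℝ) : HasDerivAt (fun s : ℝ => Real.exp (2 * s))
    (2 * Real.exp (2 * s)) s := by
  have := ((hasDerivAt_id s).const_mul 2).exp
  simp only [id, mul_one] at this
  rwa [mul_comm] at this

theorem exists_lower (h : IsLogProfile N w p q) :
    ∃ m > 0, ∀ s ≤ 0, m * Real.exp (2 * s) ≤ w s := by
  refine ⟨w 0, h.pos 0, fun s hs => ?_⟩
  have hanti := antitoneOn_Iic_of_hasDerivAt (b := 0)
    (fun s _ => (h.deriv_w s).div (hasDerivAt_exp_two s) (Real.exp_pos _).ne') (fun s _ => by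
      have := h.deriv_le s
      have := Real.exp_pos (2 * s)
      apply div_nonpos_of_nonpos_of_nonneg _ (by positivity)
      nlinarith)
  have := hanti (mem_Iic.2 hs) (mem_Iic.2 le_rfl) hs
  simp only [Pi.div_apply, mul_zero, Real.exp_zero, div_one] at this
  rwa [le_div_iff₀ (Real.exp_pos _)] at this

theorem exists_upper (h : IsLogProfile N w p q) :
    ∃ C > 0, ∃ b ≤ 0, ∀ s ≤ b, w s ≤ 1 / 4 ∧ w s ≤ C * Real.exp (2 * s) := by
  obtain ⟨b, hb⟩ := ((h.tendsto.eventually_lt_const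
    (show (0 : ℝ) < 1 / 4 by norm_num)).and (eventually_le_atBot 0)).exists
  have hwb := h.pos b
  -- This quantity is constant along solutions of the comparison equation `w' = 2w - 4w²`.
  have hd : ∀ s, HasDerivAt (fun s => Real.exp (2 * s) * ((w s)⁻¹ - 2))
      (2 * Real.exp (2 * s) * ((w s)⁻¹ - 2) + Real.exp (2 * s) * (-p s / w s ^ 2)) s := fun s =>
    (hasDerivAt_exp_two s).mul (((h.deriv_w s).inv (h.pos s).ne').sub_const 2)
  have hanti := antitoneOn_Iic_of_hasDerivAt (b := b) (fun s _ => hd s) (fun s _ => by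
    have hw := h.pos s
    have : 2 * Real.exp (2 * s) * ((w s)⁻¹ - 2) + Real.exp (2 * s) * (-p s / w s ^ 2)
      = -(Real.exp (2 * s) / w s ^ 2 * (p s - (2 * w s - 4 * w s ^ 2))) := by
      field_simp; ring
    rw [this]
    have := h.le_deriv s
    have : 0 ≤ p s - (2 * w s - 4 * w s ^ 2) := by linarith
    have h0 : 0 ≤ Real.exp (2 * s) / w s ^ 2 := by positivity
    nlinarith [mul_nonneg h0 this])
  have hm : 0 < Real.exp (2 * b) * ((w b)⁻¹ - 2) := by
    have : 4 < (w b)⁻¹ := by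
      rw [lt_inv_comm₀ (by norm_num) hwb]; linarith [hb.1]
    have : 0 < (w b)⁻¹ - 2 := by linarith
    positivity
  set m := Real.exp (2 * b) * ((w b)⁻¹ - 2) with hm_def
  refine ⟨m⁻¹, inv_pos.2 hm, b, hb.2, fun s hs => ⟨?_, ?_⟩⟩
  · have hmono : Monotone w := monotone_of_hasDerivAt_nonneg h.deriv_w fun s => (h.deriv_pos s).le
    linarith [hmono hs, hb.1]
  · have h1 : m ≤ Real.exp (2 * s) * ((w s)⁻¹ - 2) :=
      hanti (mem_Iic.2 hs) (mem_Iic.2 le_rfl) hs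
    have hw := h.pos s
    have he := Real.exp_pos (2 * s)
    have h2 : m ≤ Real.exp (2 * s) * (w s)⁻¹ := by nlinarith
    rw [← div_eq_inv_mul, le_div_iff₀ hm]
    calc w s * m ≤ w s * (Real.exp (2 * s) * (w s)⁻¹) := by gcongr
      _ = Real.exp (2 * s) := by field_simp

/-- Differentiating the autonomous equation puts `p` in the kernel of the linearization; this is the
dilation invariance of the profile equation. -/
theorem hasDerivAt_q (h : IsLogProfile N w p q) (s : ℝ) : ∃ r, HasDerivAt q r s ∧
    (1 - w s) * r + (N - 2 + 2 * w s) * q s + 2 * p s ^ 2 - 2 * N * (1 - 2 * w s) * p s = 0 := by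
  have hne : ∀ s, 1 - w s ≠ 0 := fun s => by have := h.lt_one s; linarith
  have hq : q = fun s => (2 * N * (w s * (1 - w s)) - 1 / 2 * p s ^ 2
      - (N - 2 + 2 * w s) * p s) / (1 - w s) := by
    funext s
    rw [eq_div_iff (hne s)]
    linear_combination h.ode s
  have hw := h.deriv_w s
  have hp := h.deriv_p s
  have hd : DifferentiableAt ℝ q s := by
    rw [hq]
    have := hw.differentiableAt
    have := hp.differentiableAt
    have := hne s
    fun_prop (disch := assumption)
  refine ⟨deriv q s, hd.hasDerivAt, ?_⟩
  have h1 := (((hw.const_sub 1).mul hd.hasDerivAt).add ((hp.pow 2).const_mul (1 / 2))).add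
    ((((hw.const_mul 2).const_add (N - 2)).mul hp)) |>.sub ((hw.mul (hw.const_sub 1)).const_mul (2 * N))
  have h2 := h1.unique ((hasDerivAt_const s (0 : ℝ)).congr_of_eventuallyEq
    (Eventually.of_forall fun s => h.ode s))
  simp only [Nat.cast_ofNat, Nat.add_one_sub_one, pow_one] at h2
  linear_combination h2

/-- The bound used for the weight in the equation of the Wronskian quotient. -/
theorem damping (h : IsLogProfile N w p q) {s : ℝ} (hs : w s ≤ 1 / 4) :
    (1 - w s) * p s ≤ (N - 2 + 2 * w s + p s) * p s + 2 * (1 - w s) * q s := by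
  have hode := h.ode s
  have hN := h.one_le
  have hw := h.pos s
  have hp := h.deriv_pos s
  have h1 := h.deriv_le s
  have h2 : 0 ≤ N * (1 - w s) * (2 * w s - p s) := by
    have : 0 ≤ 1 - w s := by linarith
    have : 0 ≤ 2 * w s - p s := by linarith
    positivity
  have h3 : 0 ≤ N * p s * (1 / 4 - w s) := by
    have : 0 ≤ 1 / 4 - w s := by linarith
    positivity
  have h4 : 0 ≤ (N - 1) * p s := mul_nonneg (by linarith) hp.le
  have h5 : 0 ≤ p s * (1 / 4 - w s) := mul_nonneg hp.le (by linarith)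
  have h6 : 2 * (1 - w s) * q s = 4 * N * (w s * (1 - w s)) - p s ^ 2
    - 2 * (N - 2 + 2 * w s) * p s := by linear_combination 2 * hode
  rw [h6]
  nlinarith

end IsLogProfile

/-! ### The correction, compared with `p` through the Wronskian. -/

/-- The equation for the correction in the logarithmic variable. -/
structure IsLogCorrection (N : ℝ) (w p q c c' c'' : ℝ → ℝ) : Prop where
  deriv_c : ∀ s, HasDerivAt c (c' s) s
  deriv_c' : ∀ s, HasDerivAt c' (c'' s) s
  ode : ∀ s, (1 - w s) * c'' s + (N - 2 + 2 * w s + p s) * c' s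
    + (2 * p s - q s - 2 * N * (1 - 2 * w s)) * c s = Real.exp (2 * s) * p s
  pos : ∀ s, 0 < c s
  bdd : ∃ M b, ∀ s ≤ b, c s ≤ M

namespace IsLogCorrection

variable {N : ℝ} {w p q c c' c'' : ℝ → ℝ}

/-- Abel's identity: the zeroth-order terms cancel because `p` solves the homogeneous equation. -/
theorem hasDerivAt_wronskian (h : IsLogProfile N w p q) (hc : IsLogCorrection N w p q c c' c'')
    (s : ℝ) : ∃ r, HasDerivAt (fun s => p s * c' s - q s * c s) r s ∧
      (1 - w s) * r = -(N - 2 + 2 * w s + p s) * (p s * c' s - q s * c s)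
        + Real.exp (2 * s) * p s ^ 2 := by
  obtain ⟨r, hr, hre⟩ := h.hasDerivAt_q s
  refine ⟨_, ((h.deriv_p s).mul (hc.deriv_c' s)).sub (hr.mul (hc.deriv_c s)), ?_⟩
  linear_combination p s * hc.ode s - c s * hre

theorem hasDerivAt_quot (h : IsLogProfile N w p q) (hc : IsLogCorrection N w p q c c' c'')
    (s : ℝ) : HasDerivAt (fun s => c s / p s) ((p s * c' s - q s * c s) / p s ^ 2) s := by
  refine ((hc.deriv_c s).div (h.deriv_p s) (h.deriv_pos s).ne').congr_deriv ?_
  ring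

/-- A negative `W` gives `-W ≥ m eˢ` to the left. Since `p` is comparable to `e²ˢ`, `c/p` then grows
like `e⁻³ˢ` and `c` like `e⁻ˢ`, against boundedness. -/
theorem wronskian_nonneg (h : IsLogProfile N w p q) (hc : IsLogCorrection N w p q c c' c'')
    (b : ℝ) : 0 ≤ p b * c' b - q b * c b := by
  by_contra! hb
  have hN := h.one_le
  choose r hr hre using hc.hasDerivAt_wronskian h
  set W := fun s => p s * c' s - q s * c s with hW
  -- The weight `e⁻ˢ` turns the coefficient `N - 2 + 2w + p`, possibly negative when `N = 1`, into
  -- `N - 1 + w + p ≥ 0`.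
  have hd : ∀ s, HasDerivAt (fun s => -W s * Real.exp (-s))
      (-r s * Real.exp (-s) + -W s * (-Real.exp (-s))) s := fun s => by
    refine ((hr s).neg.mul (hasDerivAt_neg s).exp).congr_deriv ?_
    simp
  have hmono : ∀ a ≤ b, -W b * Real.exp (-b) ≤ -W a * Real.exp (-a) := fun a hab => by
    refine le_of_deriv_nonpos_of_pos (fun s _ => hd s) (fun s _ hs => ?_)
      (mul_pos (by simpa [hW] using hb) (Real.exp_pos _)) hab
    have hWs : 0 < -W s := pos_of_mul_pos_left hs (Real.exp_pos _).le
    have h1 : 0 < 1 - w s := by linarith [h.lt_one s]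
    have h2 := hre s
    have hw := h.pos s
    have hp := h.deriv_pos s
    have h3 : (1 - w s) * (-r s - -W s) ≤ 0 := by
      have : (1 - w s) * (-r s - -W s)
          = -((N - 1 + w s + p s) * (-W s) + Real.exp (2 * s) * p s ^ 2) := by
        linear_combination -h2
      rw [this]
      have : 0 ≤ N - 1 + w s + p s := by linarith
      have := mul_nonneg this hWs.le
      have : 0 ≤ Real.exp (2 * s) * p s ^ 2 := by positivity
      linarith
    have h4 : -r s - -W s ≤ 0 := nonpos_of_mul_nonpos_right h3 h1
    nlinarith [Real.exp_pos (-s)]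
  set m := -W b * Real.exp (-b) with hm
  have hm0 : 0 < m := mul_pos (by simpa [hW] using hb) (Real.exp_pos _)
  obtain ⟨C, hC, b₁, hb₁, hup⟩ := h.exists_upper
  obtain ⟨l, hl, hlow⟩ := h.exists_lower
  obtain ⟨M, b₂, hM⟩ := hc.bdd
  set a := min b (min b₁ b₂)
  set μ := m / (2 * C) ^ 2 with hμ
  have hμ0 : 0 < μ := by positivity
  have hexp3 : ∀ s : ℝ, HasDerivAt (fun s : ℝ => Real.exp (-(3 * s))) (-3 * Real.exp (-(3 * s))) s :=
    fun s => by
    have := (((hasDerivAt_id s).const_mul 3).neg).exp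
    simp only [Pi.neg_apply, id, mul_one] at this
    rwa [mul_comm] at this
  have hanti := antitoneOn_Iic_of_hasDerivAt (b := a)
    (fun s _ => (hc.hasDerivAt_quot h s).sub ((hexp3 s).const_mul (μ / 3))) (fun s hs => by
      have hsb : s ≤ b := hs.trans (min_le_left _ _)
      have hs1 : s ≤ b₁ := hs.trans ((min_le_right _ _).trans (min_le_left _ _))
      have h1 := hmono s hsb
      have hp := h.deriv_pos s
      have hpC : p s ≤ 2 * C * Real.exp (2 * s) := by linarith [h.deriv_le s, (hup s hs1).2]
      have h2 : m * Real.exp s ≤ -W s := by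
        calc m * Real.exp s ≤ (-W s * Real.exp (-s)) * Real.exp s := by gcongr
          _ = -W s := by rw [mul_assoc, ← Real.exp_add]; simp
      have h3 : p s ^ 2 ≤ (2 * C * Real.exp (2 * s)) ^ 2 := by gcongr
      have h4 : μ * Real.exp (-(3 * s)) ≤ -W s / p s ^ 2 := by
        rw [le_div_iff₀ (by positivity)]
        calc μ * Real.exp (-(3 * s)) * p s ^ 2
            ≤ μ * Real.exp (-(3 * s)) * (2 * C * Real.exp (2 * s)) ^ 2 := by gcongr
          _ = m * (Real.exp (-(3 * s)) * Real.exp (2 * s) ^ 2) := by rw [hμ]; field_simp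
          _ = m * Real.exp s := by
            rw [← Real.exp_nat_mul, ← Real.exp_add]; congr 2; push_cast; ring
          _ ≤ _ := h2
      have h5 : (p s * c' s - q s * c s) / p s ^ 2 = -(-W s / p s ^ 2) := by
        rw [neg_div, neg_neg]
      rw [h5]
      linarith)
  set K := c a / p a - μ / 3 * Real.exp (-(3 * a)) with hK
  have hgr : ∀ s ≤ a, μ / 3 * Real.exp (-(3 * s)) + K ≤ c s / p s := fun s hs => by
    have := hanti (mem_Iic.2 hs) (mem_Iic.2 le_rfl) hs
    simp only [Pi.sub_apply] at this
    linarith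
  have hbd : ∀ s ≤ a, μ / 3 * Real.exp (-s) ≤ M / l + |K| := fun s hs => by
    have hs1 : s ≤ b₁ := hs.trans ((min_le_right _ _).trans (min_le_left _ _))
    have hs2 : s ≤ b₂ := hs.trans ((min_le_right _ _).trans (min_le_right _ _))
    have hs0 : s ≤ 0 := hs1.trans hb₁
    have hp := h.deriv_pos s
    have he := Real.exp_pos (2 * s)
    have hwp : l * Real.exp (2 * s) ≤ p s := by
      have := hlow s hs0
      have := (hup s hs1).1
      have := h.le_deriv s
      have := h.pos s
      nlinarith
    have hc0 := hc.pos s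
    have h1 : c s / p s * Real.exp (2 * s) ≤ M / l := by
      rw [div_mul_eq_mul_div, div_le_div_iff₀ hp hl]
      have := hM s hs2
      nlinarith
    have h2 := mul_le_mul_of_nonneg_right (hgr s hs) he.le
    have h3 : Real.exp (-(3 * s)) * Real.exp (2 * s) = Real.exp (-s) := by
      rw [← Real.exp_add]; congr 1; ring
    have h4 : Real.exp (2 * s) ≤ 1 := Real.exp_le_one_iff.2 (by linarith)
    have h5 : -|K| ≤ K * Real.exp (2 * s) := by
      have := neg_abs_le (K * Real.exp (2 * s))
      rw [abs_mul, abs_of_pos he] at this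
      have := mul_le_mul_of_nonneg_left h4 (abs_nonneg K)
      linarith
    rw [add_mul, mul_assoc, h3] at h2
    linarith
  have htend : Tendsto (fun s : ℝ => μ / 3 * Real.exp (-s)) atBot atTop :=
    (Real.tendsto_exp_atTop.comp tendsto_neg_atBot_atTop).const_mul_atTop (by positivity)
  obtain ⟨s, hs, hs'⟩ := ((htend.eventually_gt_atTop (M / l + |K|)).and
    (eventually_le_atBot a)).exists
  linarith [hbd s hs']

/-- By `damping`, `W/p²` is nonincreasing while above `2`, so an excess persists backwards. Then
`c/p` has slope above `2` on a half-line and loses positivity. -/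
theorem wronskian_le (h : IsLogProfile N w p q) (hc : IsLogCorrection N w p q c c' c'')
    {b : ℝ} (hb0 : b ≤ 0) (hwb : ∀ s ≤ b, w s ≤ 1 / 4) :
    (p b * c' b - q b * c b) / p b ^ 2 ≤ 2 := by
  by_contra! hb
  choose r hr hre using hc.hasDerivAt_wronskian h
  set W := fun s => p s * c' s - q s * c s with hW
  have hd : ∀ s, HasDerivAt (fun s => W s / p s ^ 2 - 2)
      ((r s * p s - 2 * W s * q s) / p s ^ 3) s := fun s => by
    have hp := h.deriv_pos s
    refine (((hr s).div ((h.deriv_p s).pow 2) (pow_pos hp 2).ne').sub_const 2).congr_deriv ?_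
    simp only [Pi.pow_apply]
    field_simp
    push_cast
    ring
  have hmono : ∀ a ≤ b, W b / p b ^ 2 - 2 ≤ W a / p a ^ 2 - 2 := fun a hab => by
    refine le_of_deriv_nonpos_of_pos (fun s _ => hd s) (fun s hs hpos => ?_) (by linarith) hab
    have hp := h.deriv_pos s
    have hw4 := hwb s hs
    have h1 : 0 < 1 - w s := by linarith
    have hWp : 2 * p s ^ 2 < W s := by
      have : 2 < W s / p s ^ 2 := by linarith
      rwa [lt_div_iff₀ (by positivity)] at this
    have hW0 : 0 < W s := lt_trans (by positivity) hWp
    have hdamp := mul_le_mul_of_nonneg_left (h.damping hw4) hW0.le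
    have he : Real.exp (2 * s) ≤ 1 := Real.exp_le_one_iff.2 (by linarith)
    have h2 : (1 - w s) * (r s * p s - 2 * W s * q s) ≤ 0 := by
      have h3 : (1 - w s) * (r s * p s - 2 * W s * q s) = Real.exp (2 * s) * p s ^ 3
          - W s * ((N - 2 + 2 * w s + p s) * p s + 2 * (1 - w s) * q s) := by
        linear_combination p s * hre s
      have h4 : Real.exp (2 * s) * p s ^ 3 ≤ 1 * p s ^ 3 := by gcongr
      -- The damping is at least `(3/2) p³` here and beats the forcing, which is at most `p³`.
      have h5 : 2 * p s ^ 2 * (3 / 4 * p s) ≤ W s * ((1 - w s) * p s) := by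
        gcongr
        linarith
      have : 0 < p s ^ 3 := by positivity
      rw [h3]
      nlinarith
    exact div_nonpos_of_nonpos_of_nonneg (nonpos_of_mul_nonpos_right h2 h1) (by positivity)
  have hanti := antitoneOn_Iic_of_hasDerivAt (b := b)
    (fun s _ => (hasDerivAt_id s).sub (hc.hasDerivAt_quot h s)) (fun s hs => by
      have := hmono s hs
      simp only [hW] at this hb
      linarith)
  have hg := div_pos (hc.pos b) (h.deriv_pos b)
  have hle : b - c b / p b ≤ b := by linarith
  have := hanti (mem_Iic.2 hle) (mem_Iic.2 le_rfl) hle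
  have := div_pos (hc.pos (b - c b / p b)) (h.deriv_pos (b - c b / p b))
  simp only [Pi.sub_apply, id] at *
  linarith

theorem exists_bound_near (h : IsLogProfile N w p q) (hc : IsLogCorrection N w p q c c' c'') :
    ∃ M b, ∀ s ≤ b, p s ≤ M * Real.exp (2 * s) ∧ c s ≤ M * p s ∧ |c' s| ≤ M * p s ∧
      |c'' s| ≤ M * p s := by
  obtain ⟨C, hC, b, hb0, hup⟩ := h.exists_upper
  have hN := h.one_le
  set K := c b / p b with hK
  have hK0 : 0 < K := div_pos (hc.pos b) (h.deriv_pos b)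
  have hmono : ∀ s ≤ b, c s ≤ K * p s := fun s hs => by
    have : Monotone fun s => c s / p s :=
      monotone_of_hasDerivAt_nonneg (hc.hasDerivAt_quot h) fun s =>
        div_nonneg (hc.wronskian_nonneg h s) (sq_nonneg _)
    exact (div_le_iff₀ (h.deriv_pos s)).1 (this hs)
  have hq : ∀ s ≤ b, |q s| ≤ 8 * N * p s := fun s hs => by
    have hw4 := (hup s hs).1
    have hw := h.pos s
    have hp := h.deriv_pos s
    have hpw := h.deriv_le s
    have hwp : w s ≤ p s := by nlinarith [h.le_deriv s]
    have hode := h.ode s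
    have hNp : p s ≤ N * p s := le_mul_of_one_le_left hp.le hN
    have hpp : 0 ≤ p s * w s := by positivity
    have hp1 : p s * p s ≤ p s * 1 := by gcongr; linarith
    have hp2 : p s * w s ≤ p s * (1 / 4) := by gcongr
    have hw1 : N * (w s * (1 - w s)) ≤ N * (p s * 1) := by gcongr <;> linarith
    have hw0 : 0 ≤ N * (w s * (1 - w s)) := by
      have : 0 ≤ 1 - w s := by linarith
      positivity
    have hb : |(1 - w s) * q s| ≤ 6 * N * p s := abs_le.2 ⟨by nlinarith, by nlinarith⟩
    rw [abs_mul, abs_of_pos (by linarith)] at hb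
    have : 3 / 4 * |q s| ≤ (1 - w s) * |q s| := by gcongr; linarith
    linarith
  have hc1 : ∀ s ≤ b, |c' s| ≤ (2 + 8 * N * K) * p s := fun s hs => by
    have hp := h.deriv_pos s
    have hc0 := hc.pos s
    have h1 := hc.wronskian_nonneg h s
    have h2 := hc.wronskian_le h (hs.trans hb0) fun a ha => (hup a (ha.trans hs)).1
    rw [div_le_iff₀ (by positivity)] at h2
    have h3 : |q s * c s| ≤ 8 * N * p s * (K * p s) := by
      rw [abs_mul, abs_of_pos hc0]
      exact mul_le_mul (hq s hs) (hmono s hs) hc0.le (by positivity)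
    have h4 : |p s * c' s| ≤ p s * ((2 + 8 * N * K) * p s) := by
      have := abs_le.1 h3
      have : 0 < p s ^ 2 := by positivity
      exact abs_le.2 ⟨by nlinarith, by nlinarith⟩
    rw [abs_mul, abs_of_pos hp] at h4
    exact le_of_mul_le_mul_left h4 hp
  set M₁ := 2 + 8 * N * K with hM₁
  have hM₁0 : 0 < M₁ := by positivity
  have hc2 : ∀ s ≤ b, |c'' s| ≤ 2 * (1 + 4 * N * M₁ + 16 * N * K) * p s := fun s hs => by
    have hp := h.deriv_pos s
    have hw := h.pos s
    have hw4 := (hup s hs).1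
    have hpw := h.deriv_le s
    have hqb := hq s hs
    have hc0 := hc.pos s
    have he : Real.exp (2 * s) ≤ 1 := Real.exp_le_one_iff.2 (by linarith)
    have h1 : |Real.exp (2 * s) * p s| ≤ 1 * p s := by
      rw [abs_of_pos (by positivity)]; gcongr
    have h2 : |(N - 2 + 2 * w s + p s) * c' s| ≤ 4 * N * (M₁ * p s) := by
      rw [abs_mul]
      refine mul_le_mul ?_ (hc1 s hs) (abs_nonneg _) (by positivity)
      exact abs_le.2 ⟨by linarith, by linarith⟩
    have h3 : |(2 * p s - q s - 2 * N * (1 - 2 * w s)) * c s| ≤ 16 * N * (K * p s) := by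
      rw [abs_mul, abs_of_pos hc0]
      refine mul_le_mul ?_ (hmono s hs) hc0.le (by positivity)
      have := abs_le.1 hqb
      have h4 : N * p s ≤ N * (1 / 2) := by gcongr; linarith
      have h5 : N * w s ≤ N * (1 / 4) := by gcongr
      have h6 : 0 < N * w s := by positivity
      exact abs_le.2 ⟨by linarith, by linarith⟩
    have h4 : |(1 - w s) * c'' s| ≤ (1 + 4 * N * M₁ + 16 * N * K) * p s := by
      have : (1 - w s) * c'' s = Real.exp (2 * s) * p s - (N - 2 + 2 * w s + p s) * c' s
        - (2 * p s - q s - 2 * N * (1 - 2 * w s)) * c s := by linear_combination hc.ode s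
      rw [this]
      have := abs_le.1 h1
      have := abs_le.1 h2
      have := abs_le.1 h3
      exact abs_le.2 ⟨by linarith, by linarith⟩
    rw [abs_mul, abs_of_pos (by linarith)] at h4
    have : 1 / 2 * |c'' s| ≤ (1 - w s) * |c'' s| := by gcongr; linarith
    linarith
  set M₂ := 2 * (1 + 4 * N * M₁ + 16 * N * K) with hM₂
  have hM₂0 : 0 < M₂ := by positivity
  refine ⟨2 * C + K + M₁ + M₂, b, fun s hs => ?_⟩
  have hp := h.deriv_pos s
  refine ⟨?_, (hmono s hs).trans ?_, (hc1 s hs).trans ?_, (hc2 s hs).trans ?_⟩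
  · calc p s ≤ 2 * C * Real.exp (2 * s) := by linarith [h.deriv_le s, (hup s hs).2]
      _ ≤ _ := by gcongr; linarith
  all_goals gcongr; linarith

/-- Compactness extends the bounds near `-∞` to any half-line, the ratios being continuous. -/
theorem exists_bound (h : IsLogProfile N w p q) (hc : IsLogCorrection N w p q c c' c'')
    (hc'' : Continuous c'') (S : ℝ) :
    ∃ M > 0, ∀ s ≤ S, p s ≤ M * Real.exp (2 * s) ∧ c s ≤ M * p s ∧ |c' s| ≤ M * p s ∧
      |c'' s| ≤ M * p s := by
  obtain ⟨M, b, hM⟩ := hc.exists_bound_near h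
  have hpc : Continuous p := continuous_iff_continuousAt.2 fun s => (h.deriv_p s).continuousAt
  have hcc : Continuous c := continuous_iff_continuousAt.2 fun s => (hc.deriv_c s).continuousAt
  have hcc' : Continuous c' := continuous_iff_continuousAt.2 fun s => (hc.deriv_c' s).continuousAt
  have hp0 : ∀ s, p s ≠ 0 := fun s => (h.deriv_pos s).ne'
  have hf : Continuous fun s => p s / Real.exp (2 * s) + c s / p s + |c' s| / p s
      + |c'' s| / p s := by
    fun_prop (disch := first | assumption | exact fun _ => (Real.exp_pos _).ne')
  obtain ⟨K, hK⟩ := (isCompact_Icc (a := b) (b := S)).exists_bound_of_continuousOn hf.continuousOn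
  refine ⟨max 1 (max M K), lt_of_lt_of_le one_pos (le_max_left _ _), fun s hs => ?_⟩
  have hp := h.deriv_pos s
  have hc0 := hc.pos s
  rcases le_total s b with hsb | hsb
  · have hle : M ≤ max 1 (max M K) := (le_max_left _ _).trans (le_max_right _ _)
    obtain ⟨h1, h2, h3, h4⟩ := hM s hsb
    refine ⟨h1.trans ?_, h2.trans ?_, h3.trans ?_, h4.trans ?_⟩
    all_goals gcongr
  · have hle : K ≤ max 1 (max M K) := (le_max_right _ _).trans (le_max_right _ _)
    have h0 := (le_abs_self _).trans (hK s ⟨hsb, hs⟩)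
    have h1 : 0 ≤ p s / Real.exp (2 * s) := by positivity
    have h2 : 0 ≤ c s / p s := by positivity
    have h3 : 0 ≤ |c' s| / p s := by positivity
    have h4 : 0 ≤ |c'' s| / p s := by positivity
    refine ⟨(div_le_iff₀ (Real.exp_pos _)).1 ?_, (div_le_iff₀ hp).1 ?_, (div_le_iff₀ hp).1 ?_,
      (div_le_iff₀ hp).1 ?_⟩
    all_goals linarith

end IsLogCorrection

/-! ### Expansion and scaling of `𝓕`. -/

/-- The linear part of `s ↦ 𝓕[V + s W]`. -/
noncomputable def linF (n : ℕ) (V W : ℝ → ℝ) (σ : ℝ) : ℝ :=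
  V σ * deriv (deriv W) σ + deriv (deriv V) σ * W σ - deriv V σ * deriv W σ
    + ((n : ℝ) - 1 - V σ) / σ * deriv W σ - W σ / σ * deriv V σ
    + 2 * ((n : ℝ) - 1) / σ ^ 2 * ((1 - 2 * V σ) * W σ)

/-- The quadratic part of `𝓕`. -/
noncomputable def quadF (n : ℕ) (W : ℝ → ℝ) (σ : ℝ) : ℝ :=
  W σ * deriv (deriv W) σ - (1 / 2) * (deriv W σ) ^ 2 - W σ / σ * deriv W σ
    - 2 * ((n : ℝ) - 1) / σ ^ 2 * (W σ) ^ 2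

theorem hasDerivAt_of_contDiffOn_two {f : ℝ → ℝ} (hf : ContDiffOn ℝ 2 f (Ioi 0)) {x : ℝ}
    (hx : 0 < x) : HasDerivAt f (deriv f x) x :=
  ((hf.differentiableOn (by norm_num)).differentiableAt (Ioi_mem_nhds hx)).hasDerivAt

theorem contDiffOn_deriv_of_contDiffOn_two {f : ℝ → ℝ} (hf : ContDiffOn ℝ 2 f (Ioi 0)) :
    ContDiffOn ℝ 1 (deriv f) (Ioi 0) := by
  have : (2 : WithTop ℕ∞) = 1 + 1 := by norm_num
  rw [this, contDiffOn_succ_iff_deriv_of_isOpen isOpen_Ioi] at hf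
  exact hf.2.2

theorem hasDerivAt_deriv_of_contDiffOn_two {f : ℝ → ℝ} (hf : ContDiffOn ℝ 2 f (Ioi 0)) {x : ℝ}
    (hx : 0 < x) : HasDerivAt (deriv f) (deriv (deriv f) x) x :=
  (((contDiffOn_deriv_of_contDiffOn_two hf).differentiableOn (by norm_num)).differentiableAt
    (Ioi_mem_nhds hx)).hasDerivAt

theorem continuousOn_deriv_deriv_of_contDiffOn_two {f : ℝ → ℝ} (hf : ContDiffOn ℝ 2 f (Ioi 0)) :
    ContinuousOn (deriv (deriv f)) (Ioi 0) :=
  (contDiffOn_deriv_of_contDiffOn_two hf).continuousOn_deriv_of_isOpen isOpen_Ioi (by norm_num)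

theorem opF_add_mul {V W : ℝ → ℝ} (hV : ContDiffOn ℝ 2 V (Ioi 0)) (hW : ContDiffOn ℝ 2 W (Ioi 0))
    (n : ℕ) (s : ℝ) {x : ℝ} (hx : 0 < x) :
    opF n (fun y => V y + s * W y) x = opF n V x + s * linF n V W x + s ^ 2 * quadF n W x := by
  have h1 : ∀ y, 0 < y → deriv (fun y => V y + s * W y) y = deriv V y + s * deriv W y :=
    fun y hy => ((hasDerivAt_of_contDiffOn_two hV hy).add
      ((hasDerivAt_of_contDiffOn_two hW hy).const_mul s)).deriv
  have h2 : deriv (deriv fun y => V y + s * W y) x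
      = deriv (deriv V) x + s * deriv (deriv W) x := by
    have : deriv (fun y => V y + s * W y) =ᶠ[𝓝 x] fun y => deriv V y + s * deriv W y := by
      filter_upwards [Ioi_mem_nhds hx] with y hy using h1 y hy
    rw [this.deriv_eq]
    exact ((hasDerivAt_deriv_of_contDiffOn_two hV hx).add
      ((hasDerivAt_deriv_of_contDiffOn_two hW hx).const_mul s)).deriv
  simp only [opF, linF, quadF]
  rw [h2, h1 x hx]
  ring

theorem dOpF_eq_linF {V W : ℝ → ℝ} (hV : ContDiffOn ℝ 2 V (Ioi 0))
    (hW : ContDiffOn ℝ 2 W (Ioi 0)) (n : ℕ) {x : ℝ} (hx : 0 < x) :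
    dOpF n V W x = linF n V W x := by
  unfold dOpF
  simp only [fun s => opF_add_mul hV hW n s hx]
  have h := (((hasDerivAt_id (0 : ℝ)).mul_const (linF n V W x)).const_add (opF n V x)).add
    (((hasDerivAt_id (0 : ℝ)).pow 2).mul_const (quadF n W x))
  refine (HasDerivAt.congr_deriv h ?_).deriv
  simp

theorem opF_comp_mul_left (n : ℕ) (f : ℝ → ℝ) {a : ℝ} (ha : a ≠ 0) (r : ℝ) :
    opF n (fun x => f (a * x)) r = a ^ 2 * opF n f (a * r) := by
  have h1 : deriv (fun x => f (a * x)) = fun x => a * deriv f (a * x) :=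
    funext fun x => by rw [deriv_comp_mul_left]; rfl
  have h2 : deriv (deriv fun x => f (a * x)) r = a * (a * deriv (deriv f) (a * r)) := by
    rw [h1, deriv_const_mul_field, deriv_comp_mul_left]; rfl
  simp only [opF]
  rw [h2, h1]
  rcases eq_or_ne r 0 with rfl | hr
  · simp; ring
  · field_simp

/-! ### Smoothness of the profile and of the correction. -/

/-- Bootstrapping for second-order equations. -/
theorem contDiffOn_infty_of_bootstrap {f : ℝ → ℝ} (hf : ContDiffOn ℝ 2 f (Ioi 0))
    (hstep : ∀ m : ℕ, ContDiffOn ℝ m f (Ioi 0) → ContDiffOn ℝ m (deriv f) (Ioi 0) →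
      ContDiffOn ℝ m (deriv (deriv f)) (Ioi 0)) : ContDiffOn ℝ ∞ f (Ioi 0) := by
  have key : ∀ m : ℕ, ContDiffOn ℝ m f (Ioi 0) ∧ ContDiffOn ℝ m (deriv f) (Ioi 0) := by
    intro m
    induction m with
    | zero =>
      exact ⟨hf.of_le (by norm_num), (contDiffOn_deriv_of_contDiffOn_two hf).of_le (by norm_num)⟩
    | succ m ih =>
      push_cast
      rw [contDiffOn_succ_iff_deriv_of_isOpen isOpen_Ioi,
        contDiffOn_succ_iff_deriv_of_isOpen isOpen_Ioi]
      exact ⟨⟨hf.differentiableOn (by norm_num), by simp, ih.2⟩,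
        (contDiffOn_deriv_of_contDiffOn_two hf).differentiableOn (by norm_num), by simp,
        hstep m ih.1 ih.2⟩
  exact contDiffOn_infty.2 fun m => (key m).1

/-- Positivity of `𝔅` makes the equation nondegenerate, so it can be solved for the second
derivative. -/
theorem IsBryantProfile.smoothOn {n : ℕ} {𝔅 : ℝ → ℝ} (h : IsBryantProfile n 𝔅) :
    ContDiffOn ℝ ∞ 𝔅 (Ioi 0) := by
  refine contDiffOn_infty_of_bootstrap h.contDiffOn fun m h0 h1 => ?_
  have hx : ∀ x ∈ Ioi (0 : ℝ), x ≠ 0 := fun x hx => ne_of_gt hx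
  have hx2 : ∀ x ∈ Ioi (0 : ℝ), x ^ 2 ≠ 0 := fun x hx => pow_ne_zero 2 (ne_of_gt hx)
  have hb : ∀ x ∈ Ioi (0 : ℝ), 𝔅 x ≠ 0 := fun x hx => (h.pos x hx).ne'
  have hid : ContDiffOn ℝ m (fun x : ℝ => x) (Ioi 0) := contDiffOn_id
  have : ContDiffOn ℝ m (fun x => ((1 / 2) * (deriv 𝔅 x) ^ 2 - ((n : ℝ) - 1 - 𝔅 x) / x * deriv 𝔅 x
      - 2 * ((n : ℝ) - 1) / x ^ 2 * (𝔅 x * (1 - 𝔅 x))) / 𝔅 x) (Ioi 0) :=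
    (((contDiffOn_const.mul (h1.pow 2)).sub (((contDiffOn_const.sub h0).div hid hx).mul h1)).sub
      ((contDiffOn_const.div (hid.pow 2) hx2).mul (h0.mul (contDiffOn_const.sub h0)))).div h0 hb
  refine this.congr fun x hx => ?_
  have := h.ode x hx
  rw [eq_div_iff (hb x hx)]
  simp only [opF] at this
  linear_combination this

theorem IsBryantCorrection.linF_eq {n : ℕ} {𝔅 ℭ : ℝ → ℝ} (h : IsBryantProfile n 𝔅)
    (hc : IsBryantCorrection n 𝔅 ℭ) {x : ℝ} (hx : 0 < x) : linF n 𝔅 ℭ x = -x * deriv 𝔅 x := by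
  rw [← dOpF_eq_linF h.contDiffOn hc.contDiffOn n hx, hc.ode x hx]

theorem IsBryantCorrection.smoothOn {n : ℕ} {𝔅 ℭ : ℝ → ℝ} (h : IsBryantProfile n 𝔅)
    (hc : IsBryantCorrection n 𝔅 ℭ) : ContDiffOn ℝ ∞ ℭ (Ioi 0) := by
  refine contDiffOn_infty_of_bootstrap hc.contDiffOn fun m h0 h1 => ?_
  have hx : ∀ x ∈ Ioi (0 : ℝ), x ≠ 0 := fun x hx => ne_of_gt hx
  have hx2 : ∀ x ∈ Ioi (0 : ℝ), x ^ 2 ≠ 0 := fun x hx => pow_ne_zero 2 (ne_of_gt hx)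
  have hb : ∀ x ∈ Ioi (0 : ℝ), 𝔅 x ≠ 0 := fun x hx => (h.pos x hx).ne'
  have hid : ContDiffOn ℝ m (fun x : ℝ => x) (Ioi 0) := contDiffOn_id
  have hB := h.smoothOn
  have hB' : ContDiffOn ℝ ∞ (deriv 𝔅) (Ioi 0) := hB.deriv_of_isOpen isOpen_Ioi (by simp)
  have b0 : ContDiffOn ℝ m 𝔅 (Ioi 0) := contDiffOn_infty.1 hB m
  have b1 : ContDiffOn ℝ m (deriv 𝔅) (Ioi 0) := contDiffOn_infty.1 hB' m
  have b2 : ContDiffOn ℝ m (deriv (deriv 𝔅)) (Ioi 0) :=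
    contDiffOn_infty.1 (hB'.deriv_of_isOpen isOpen_Ioi (by simp)) m
  have : ContDiffOn ℝ m (fun x => (-x * deriv 𝔅 x - deriv (deriv 𝔅) x * ℭ x + deriv 𝔅 x * deriv ℭ x
      - ((n : ℝ) - 1 - 𝔅 x) / x * deriv ℭ x + ℭ x / x * deriv 𝔅 x
      - 2 * ((n : ℝ) - 1) / x ^ 2 * ((1 - 2 * 𝔅 x) * ℭ x)) / 𝔅 x) (Ioi 0) :=
    ((((((hid.neg.mul b1).sub (b2.mul h0)).add (b1.mul h1)).sub
      (((contDiffOn_const.sub b0).div hid hx).mul h1)).add ((h0.div hid hx).mul b1)).sub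
      ((contDiffOn_const.div (hid.pow 2) hx2).mul
        ((contDiffOn_const.sub (contDiffOn_const.mul b0)).mul h0))).div b0 hb
  refine this.congr fun x hx => ?_
  have := hc.linF_eq h hx
  rw [eq_div_iff (hb x hx)]
  simp only [linF] at this
  linear_combination this

/-! ### Passage between `σ` and `s = log σ`. -/

theorem hasDerivAt_comp_exp {f : ℝ → ℝ} (hf : ContDiffOn ℝ 2 f (Ioi 0)) (s : ℝ) :
    HasDerivAt (fun s => f (Real.exp s)) (Real.exp s * deriv f (Real.exp s)) s :=
  ((hasDerivAt_of_contDiffOn_two hf (Real.exp_pos s)).comp s (Real.hasDerivAt_exp s)).congr_deriv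
    (mul_comm _ _)

theorem hasDerivAt_deriv_comp_exp {f : ℝ → ℝ} (hf : ContDiffOn ℝ 2 f (Ioi 0)) (s : ℝ) :
    HasDerivAt (fun s => Real.exp s * deriv f (Real.exp s))
      (Real.exp s * deriv f (Real.exp s) + Real.exp s ^ 2 * deriv (deriv f) (Real.exp s)) s :=
  ((Real.hasDerivAt_exp s).mul ((hasDerivAt_deriv_of_contDiffOn_two hf (Real.exp_pos s)).comp s
    (Real.hasDerivAt_exp s))).congr_deriv (by
      simp only [Function.comp_apply]; ring)

theorem IsBryantProfile.isLogProfile {n : ℕ} (hn : 2 ≤ n) {𝔅 : ℝ → ℝ} (h : IsBryantProfile n 𝔅) :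
    IsLogProfile ((n : ℝ) - 1) (fun s => 1 - 𝔅 (Real.exp s))
      (fun s => -(Real.exp s * deriv 𝔅 (Real.exp s)))
      (fun s => -(Real.exp s * deriv 𝔅 (Real.exp s)
        + Real.exp s ^ 2 * deriv (deriv 𝔅) (Real.exp s))) where
  one_le := by
    have : (2 : ℝ) ≤ n := by exact_mod_cast hn
    linarith
  deriv_w s := (hasDerivAt_comp_exp h.contDiffOn s).const_sub 1
  deriv_p s := (hasDerivAt_deriv_comp_exp h.contDiffOn s).neg
  ode s := by
    have h1 := h.ode _ (Real.exp_pos s)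
    have he := (Real.exp_pos s).ne'
    simp only [opF] at h1
    field_simp at h1
    linear_combination -h1 / 2
  pos s := by linarith [h.lt_one _ (Real.exp_pos s)]
  lt_one s := by linarith [h.pos _ (Real.exp_pos s)]
  tendsto := by
    have := (h.tendsto_zero.comp Real.tendsto_exp_atBot_nhdsGT).const_sub 1
    simpa using this

theorem IsBryantCorrection.isLogCorrection {n : ℕ} {𝔅 ℭ : ℝ → ℝ}
    (h : IsBryantProfile n 𝔅) (hc : IsBryantCorrection n 𝔅 ℭ) :
    IsLogCorrection ((n : ℝ) - 1) (fun s => 1 - 𝔅 (Real.exp s))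
      (fun s => -(Real.exp s * deriv 𝔅 (Real.exp s)))
      (fun s => -(Real.exp s * deriv 𝔅 (Real.exp s)
        + Real.exp s ^ 2 * deriv (deriv 𝔅) (Real.exp s)))
      (fun s => ℭ (Real.exp s)) (fun s => Real.exp s * deriv ℭ (Real.exp s))
      (fun s => Real.exp s * deriv ℭ (Real.exp s)
        + Real.exp s ^ 2 * deriv (deriv ℭ) (Real.exp s)) where
  deriv_c := hasDerivAt_comp_exp hc.contDiffOn
  deriv_c' := hasDerivAt_deriv_comp_exp hc.contDiffOn
  ode s := by
    have h1 := hc.linF_eq h (Real.exp_pos s)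
    have he := (Real.exp_pos s).ne'
    have h2 : Real.exp (2 * s) = Real.exp s ^ 2 := by rw [← Real.exp_nat_mul]; norm_num
    simp only [linF] at h1
    field_simp at h1
    rw [h2]
    linear_combination h1
  pos s := hc.pos _ (Real.exp_pos s)
  bdd := by
    obtain ⟨M, δ, hδ, hM⟩ := hc.bounded_zero
    refine ⟨M, Real.log δ - 1, fun s hs => hM _ (Real.exp_pos s) ?_⟩
    rw [← Real.lt_log_iff_exp_lt hδ]
    linarith

theorem IsBryantProfile.neg_mul_deriv_pos {n : ℕ} (hn : 2 ≤ n) {𝔅 : ℝ → ℝ}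
    (h : IsBryantProfile n 𝔅) {x : ℝ} (hx : 0 < x) : 0 < -(x * deriv 𝔅 x) := by
  have := (h.isLogProfile hn).deriv_pos (Real.log x)
  rwa [Real.exp_log hx] at this

/-- On `(0, X]` the correction and the error terms are controlled by `-σ 𝔅'(σ)`. -/
theorem IsBryantCorrection.exists_bound {n : ℕ} (hn : 2 ≤ n) {𝔅 ℭ : ℝ → ℝ}
    (h : IsBryantProfile n 𝔅) (hc : IsBryantCorrection n 𝔅 ℭ) (X : ℝ) :
    ∃ M > 0, ∀ x, 0 < x → x ≤ X → |ℭ x| ≤ M * -(x * deriv 𝔅 x) ∧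
      |x * deriv ℭ x| ≤ M * -(x * deriv 𝔅 x) ∧ |quadF n ℭ x| ≤ M * -(x * deriv 𝔅 x) := by
  have hcont : Continuous fun s => Real.exp s * deriv ℭ (Real.exp s)
      + Real.exp s ^ 2 * deriv (deriv ℭ) (Real.exp s) := by
    have h1 : Continuous fun s => Real.exp s * deriv ℭ (Real.exp s) :=
      continuous_iff_continuousAt.2 fun s =>
        (hasDerivAt_deriv_comp_exp hc.contDiffOn s).continuousAt
    have h2 : Continuous fun s => deriv (deriv ℭ) (Real.exp s) :=
      (continuousOn_deriv_deriv_of_contDiffOn_two hc.contDiffOn).comp_continuous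
        Real.continuous_exp fun s => Real.exp_pos s
    exact h1.add ((Real.continuous_exp.pow 2).mul h2)
  obtain ⟨M, hM, hb⟩ := (hc.isLogCorrection h).exists_bound (h.isLogProfile hn) hcont (Real.log X)
  have hN : 0 ≤ (n : ℝ) - 1 := by
    have : (2 : ℝ) ≤ n := by exact_mod_cast hn
    linarith
  -- The first term serves `ℭ` and `xℭ'`. For the quadratic part, `x² quadF` is at most `(4 + 2N)(M
  -- p)²`, and `p ≤ M x²` trades one factor `p` for the `x²` to be divided out.
  refine ⟨M + M ^ 3 * (4 + 2 * ((n : ℝ) - 1)), by positivity, fun x hx hxX => ?_⟩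
  have hp := h.neg_mul_deriv_pos hn hx
  have hs := hb (Real.log x) (Real.log_le_log hx hxX)
  have h2 : Real.exp (2 * Real.log x) = x ^ 2 := by
    rw [mul_comm, Real.exp_mul, Real.exp_log hx]; norm_num
  simp only [Real.exp_log hx, h2] at hs
  set p := -(x * deriv 𝔅 x)
  set N := (n : ℝ) - 1
  obtain ⟨h3, h4, h5, h6⟩ := hs
  have hC := hc.pos x hx
  have hle : M * p ≤ (M + M ^ 3 * (4 + 2 * N)) * p := by
    have : 0 ≤ M ^ 3 * (4 + 2 * N) := by positivity
    gcongr; linarith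
  refine ⟨by rw [abs_of_pos hC]; exact h4.trans hle, h5.trans hle, ?_⟩
  set c := ℭ x
  set c' := x * deriv ℭ x with hc'
  set c'' := c' + x ^ 2 * deriv (deriv ℭ) x with hc''
  have hq : x ^ 2 * quadF n ℭ x = c * (c'' - c') - 1 / 2 * c' ^ 2 - c * c' - 2 * N * c ^ 2 := by
    rw [hc'', hc']
    simp only [quadF]
    field_simp
    ring
  have hm : ∀ a b : ℝ, |a| ≤ M * p → |b| ≤ M * p → |a * b| ≤ (M * p) ^ 2 := fun a b ha hb => by
    rw [abs_mul, sq]; gcongr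
  have hca : |c| ≤ M * p := by rwa [abs_of_pos hC]
  have e1 := abs_le.1 (hm c c'' hca h6)
  have e2 := abs_le.1 (hm c c' hca h5)
  have e3 := abs_le.1 (hm c' c' h5 h5)
  have e4 := abs_le.1 (hm c c hca hca)
  have e5 : N * (c * c) ≤ N * (M * p) ^ 2 := by gcongr; exact e4.2
  have e6 : 0 ≤ N * (c * c) := mul_nonneg hN (mul_self_nonneg _)
  have e7 : |x ^ 2 * quadF n ℭ x| ≤ (4 + 2 * N) * (M * p) ^ 2 := by
    rw [hq]
    exact abs_le.2 ⟨by nlinarith, by nlinarith⟩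
  rw [abs_mul, abs_of_pos (by positivity)] at e7
  have e8 : (4 + 2 * N) * (M * p) ^ 2 ≤ x ^ 2 * (M ^ 3 * (4 + 2 * N) * p) := by
    calc (4 + 2 * N) * (M * p) ^ 2 = (4 + 2 * N) * M ^ 2 * p * p := by ring
      _ ≤ (4 + 2 * N) * M ^ 2 * p * (M * x ^ 2) := by gcongr
      _ = _ := by ring
  have e9 := le_of_mul_le_mul_left (e7.trans e8) (by positivity : 0 < x ^ 2)
  have : 0 < M * p := by positivity
  linarith

/-! ### The length scale and its rate. -/

section Theta

variable {t : ℝ}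

theorem neg_log_pos (ht0 : 0 < t) (ht1 : t < 1) : 0 < -Real.log t := by
  linarith [Real.log_neg ht0 ht1]

theorem theta_pos (ht0 : 0 < t) (ht1 : t < 1) : 0 < theta t :=
  Real.sqrt_pos.2 (div_pos ht0 (neg_log_pos ht0 ht1))

theorem theta_sq (ht0 : 0 < t) (ht1 : t < 1) : theta t ^ 2 = t / (-Real.log t) :=
  Real.sq_sqrt (div_pos ht0 (neg_log_pos ht0 ht1)).le

/-- The closed form of `θ θ_t`. -/
noncomputable def thetaRate (t : ℝ) : ℝ := (-Real.log t + 1) / (2 * (-Real.log t) ^ 2)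

theorem hasDerivAt_theta (ht0 : 0 < t) (ht1 : t < 1) :
    HasDerivAt theta (thetaRate t / theta t) t := by
  have hL := neg_log_pos ht0 ht1
  have h := ((hasDerivAt_id t).div (Real.hasDerivAt_log ht0.ne').neg hL.ne').sqrt
    (div_pos ht0 hL).ne'
  refine HasDerivAt.congr_deriv h ?_
  have hθ := (theta_pos ht0 ht1).ne'
  change _ / (2 * theta t) = _
  simp only [thetaRate, id, Pi.neg_apply]
  set L := -Real.log t with hLdef
  field_simp
  ring

theorem theta_mul_deriv (ht0 : 0 < t) (ht1 : t < 1) : theta t * deriv theta t = thetaRate t := by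
  rw [(hasDerivAt_theta ht0 ht1).deriv, mul_div_cancel₀ _ (theta_pos ht0 ht1).ne']

theorem hasDerivAt_thetaRate (ht0 : 0 < t) (ht1 : t < 1) :
    HasDerivAt thetaRate ((-Real.log t + 2) / (2 * t * (-Real.log t) ^ 3)) t := by
  have hL := neg_log_pos ht0 ht1
  have hl := (Real.hasDerivAt_log ht0.ne').neg
  have h := (hl.add_const 1).div ((hl.pow 2).const_mul 2)
    (by simp only [Pi.pow_apply, Pi.neg_apply]; positivity)
  refine HasDerivAt.congr_deriv h ?_
  simp only [Pi.pow_apply, Pi.neg_apply]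
  set L := -Real.log t with hLdef
  field_simp
  ring

theorem contDiffAt_thetaRate (ht0 : 0 < t) (ht1 : t < 1) : ContDiffAt ℝ ∞ thetaRate t := by
  have hL := neg_log_pos ht0 ht1
  have hl : ContDiffAt ℝ ∞ (fun t => -Real.log t) t := (Real.contDiffAt_log.2 ht0.ne').neg
  exact (hl.add contDiffAt_const).div (contDiffAt_const.mul (hl.pow 2)) (by positivity)

theorem contDiffAt_theta (ht0 : 0 < t) (ht1 : t < 1) : ContDiffAt ℝ ∞ theta t := by
  have hL := neg_log_pos ht0 ht1
  have hl : ContDiffAt ℝ ∞ (fun t => -Real.log t) t := (Real.contDiffAt_log.2 ht0.ne').neg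
  exact (contDiffAt_id.div hl hL.ne').sqrt (div_pos ht0 hL).ne'

end Theta

/-! ### Both sides of the equation evaluated on the barrier. -/

section Barrier

variable {n : ℕ} {𝔅 ℭ : ℝ → ℝ} {k c r t : ℝ}

theorem innerBarrier_eq (ht0 : 0 < t) (ht1 : t < 1) (r : ℝ) :
    innerBarrier 𝔅 ℭ k c r t = 𝔅 (k * (r / theta t))
      + c * thetaRate t * (k ^ 2)⁻¹ * ℭ (k * (r / theta t)) := by
  rw [innerBarrier, theta_mul_deriv ht0 ht1]

theorem contDiffAt_innerBarrier (h : IsBryantProfile n 𝔅) (hc : IsBryantCorrection n 𝔅 ℭ)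
    (hk : 0 < k) (hr : 0 < r) (ht0 : 0 < t) (ht1 : t < 1) :
    ContDiffAt ℝ ∞ (fun p : ℝ × ℝ => innerBarrier 𝔅 ℭ k c p.1 p.2) (r, t) := by
  have hθ := theta_pos ht0 ht1
  have hx : 0 < k * (r / theta t) := by positivity
  have h1 : ContDiffAt ℝ ∞ (fun p : ℝ × ℝ => theta p.2) (r, t) :=
    ContDiffAt.comp (g := theta) (r, t) (contDiffAt_theta ht0 ht1) contDiffAt_snd
  have h2 : ContDiffAt ℝ ∞ (fun p : ℝ × ℝ => thetaRate p.2) (r, t) :=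
    ContDiffAt.comp (g := thetaRate) (r, t) (contDiffAt_thetaRate ht0 ht1) contDiffAt_snd
  have h3 : ContDiffAt ℝ ∞ (fun p : ℝ × ℝ => k * (p.1 / theta p.2)) (r, t) :=
    contDiffAt_const.mul (contDiffAt_fst.div h1 hθ.ne')
  have hB : ContDiffAt ℝ ∞ (fun p : ℝ × ℝ => 𝔅 (k * (p.1 / theta p.2))) (r, t) :=
    ContDiffAt.comp (g := 𝔅) (r, t) (h.smoothOn.contDiffAt (Ioi_mem_nhds hx)) h3
  have hC : ContDiffAt ℝ ∞ (fun p : ℝ × ℝ => ℭ (k * (p.1 / theta p.2))) (r, t) :=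
    ContDiffAt.comp (g := ℭ) (r, t) ((hc.smoothOn h).contDiffAt (Ioi_mem_nhds hx)) h3
  have h4 : ContDiffAt ℝ ∞ (fun p : ℝ × ℝ => c * thetaRate p.2 * (k ^ 2)⁻¹) (r, t) :=
    (contDiffAt_const.mul h2).mul contDiffAt_const
  refine (hB.add (h4.mul hC)).congr_of_eventuallyEq ?_
  have hev : ∀ᶠ p : ℝ × ℝ in 𝓝 (r, t), p.2 ∈ Ioo (0 : ℝ) 1 :=
    continuousAt_snd.eventually (Ioo_mem_nhds ht0 ht1)
  filter_upwards [hev] with p hp using innerBarrier_eq hp.1 hp.2 p.1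

theorem opF_innerBarrier (h : IsBryantProfile n 𝔅) (hc : IsBryantCorrection n 𝔅 ℭ)
    (hk : 0 < k) (hr : 0 < r) (ht0 : 0 < t) (ht1 : t < 1) {x : ℝ} (hxdef : x = k * (r / theta t)) :
    opF n (fun y => innerBarrier 𝔅 ℭ k c y t) r = thetaRate t / theta t ^ 2 *
      (c * -(x * deriv 𝔅 x) + c ^ 2 * thetaRate t * (k ^ 2)⁻¹ * quadF n ℭ x) := by
  have hθ := theta_pos ht0 ht1
  have hx : 0 < x := by rw [hxdef]; positivity
  set l := c * thetaRate t * (k ^ 2)⁻¹ with hl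
  have hfun : (fun y => innerBarrier 𝔅 ℭ k c y t)
      = fun y => (fun z => 𝔅 z + l * ℭ z) (k / theta t * y) := by
    funext y
    rw [innerBarrier_eq ht0 ht1, show k / theta t * y = k * (y / theta t) by ring]
  have hxr : k / theta t * r = x := by rw [hxdef]; ring
  rw [hfun, opF_comp_mul_left n (fun z => 𝔅 z + l * ℭ z) (by positivity), hxr,
    opF_add_mul h.contDiffOn hc.contDiffOn n l hx, h.ode x hx, hc.linF_eq h hx, hl]
  field_simp
  ring

theorem deriv_innerBarrier (h : IsBryantProfile n 𝔅) (hc : IsBryantCorrection n 𝔅 ℭ)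
    (hk : 0 < k) (hr : 0 < r) (ht0 : 0 < t) (ht1 : t < 1) {x : ℝ} (hxdef : x = k * (r / theta t)) :
    deriv (fun s => innerBarrier 𝔅 ℭ k c r s) t = thetaRate t / theta t ^ 2 * -(x * deriv 𝔅 x)
      + c * (k ^ 2)⁻¹ * ((-Real.log t + 2) / (2 * t * (-Real.log t) ^ 3) * ℭ x
        - thetaRate t * (thetaRate t / theta t ^ 2) * (x * deriv ℭ x)) := by
  have hθ := theta_pos ht0 ht1
  have hx : 0 < x := by rw [hxdef]; positivity
  have hev : (fun s => innerBarrier 𝔅 ℭ k c r s) =ᶠ[𝓝 t] fun s => 𝔅 (k * (r / theta s))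
      + c * thetaRate s * (k ^ 2)⁻¹ * ℭ (k * (r / theta s)) := by
    filter_upwards [Ioo_mem_nhds ht0 ht1] with s hs using innerBarrier_eq hs.1 hs.2 r
  have hX : HasDerivAt (fun s => k * (r / theta s)) (-(x * (thetaRate t / theta t ^ 2))) t := by
    refine ((((hasDerivAt_const t r).div (hasDerivAt_theta ht0 ht1) hθ.ne')).const_mul
      k).congr_deriv ?_
    rw [hxdef]
    field_simp
    ring
  have hB : HasDerivAt (fun s => 𝔅 (k * (r / theta s)))
      (deriv 𝔅 x * -(x * (thetaRate t / theta t ^ 2))) t := by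
    have := hasDerivAt_of_contDiffOn_two h.contDiffOn hx
    rw [hxdef] at this
    have := HasDerivAt.comp t this hX
    rwa [← hxdef] at this
  have hC : HasDerivAt (fun s => ℭ (k * (r / theta s)))
      (deriv ℭ x * -(x * (thetaRate t / theta t ^ 2))) t := by
    have := hasDerivAt_of_contDiffOn_two hc.contDiffOn hx
    rw [hxdef] at this
    have := HasDerivAt.comp t this hX
    rwa [← hxdef] at this
  rw [hev.deriv_eq]
  refine (HasDerivAt.congr_deriv (hB.add ((((hasDerivAt_thetaRate ht0 ht1).const_mul c).mul_const
    ((k ^ 2)⁻¹)).mul hC)) ?_).deriv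
  rw [← hxdef]
  ring

/-- The defect `v_t - 𝓕[v]` equals `(1 - c) (-σ 𝔅') θ_t / θ` up to an error controlled by
`(-σ 𝔅') θ_t / (θ (-log t))`. -/
theorem abs_defect_le (h : IsBryantProfile n 𝔅) (hc : IsBryantCorrection n 𝔅 ℭ)
    (hk : 0 < k) (hr : 0 < r) (ht0 : 0 < t) (ht1 : t < 1) (hL : 1 ≤ -Real.log t) {x M : ℝ}
    (hxdef : x = k * (r / theta t)) (h1 : |ℭ x| ≤ M * -(x * deriv 𝔅 x))
    (h2 : |x * deriv ℭ x| ≤ M * -(x * deriv 𝔅 x)) (h3 : |quadF n ℭ x| ≤ M * -(x * deriv 𝔅 x)) :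
    |deriv (fun s => innerBarrier 𝔅 ℭ k c r s) t - opF n (fun y => innerBarrier 𝔅 ℭ k c y t) r
      - thetaRate t / theta t ^ 2 * ((1 - c) * -(x * deriv 𝔅 x))|
      ≤ thetaRate t / theta t ^ 2 *
        (|c| * (k ^ 2)⁻¹ * (3 + |c|) * (M * -(x * deriv 𝔅 x)) / -Real.log t) := by
  rw [opF_innerBarrier h hc hk hr ht0 ht1 hxdef, deriv_innerBarrier h hc hk hr ht0 ht1 hxdef]
  set L := -Real.log t with hLdef
  set P := -(x * deriv 𝔅 x)
  have hθ := theta_pos ht0 ht1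
  have hL0 : 0 < L := by linarith
  have hA : thetaRate t = (L + 1) / (2 * L ^ 2) := rfl
  have hA0 : 0 < thetaRate t := by rw [hA]; positivity
  have hAL : thetaRate t ≤ 1 / L := by
    rw [hA, div_le_div_iff₀ (by positivity) hL0]
    nlinarith
  have hD : thetaRate t / theta t ^ 2 = (L + 1) / (2 * t * L) := by
    rw [theta_sq ht0 ht1, hA, ← hLdef]
    field_simp
  -- The ratio of `(θ θ_t)_t` to `θ_t/θ`. For `L ≥ 1`, both `ρ` and `θ θ_t` are `O(1/L)`, hence
  -- every error term is.
  set ρ := (L + 2) / (L ^ 2 * (L + 1)) with hρ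
  have hρD : (L + 2) / (2 * t * L ^ 3) = thetaRate t / theta t ^ 2 * ρ := by
    rw [hD, hρ]
    field_simp
  have hρ0 : 0 ≤ ρ := by positivity
  have hρL : ρ ≤ 2 / L := by
    rw [hρ, div_le_div_iff₀ (by positivity) hL0]
    nlinarith [mul_nonneg hL0.le hL0.le]
  have hD0 : 0 < thetaRate t / theta t ^ 2 := by positivity
  have hMP : 0 ≤ M * P := (abs_nonneg _).trans h1
  rw [hρD]
  set D := thetaRate t / theta t ^ 2
  set A := thetaRate t
  have heq : D * P + c * (k ^ 2)⁻¹ * (D * ρ * ℭ x - A * D * (x * deriv ℭ x))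
      - D * (c * P + c ^ 2 * A * (k ^ 2)⁻¹ * quadF n ℭ x) - D * ((1 - c) * P)
      = D * (c * (k ^ 2)⁻¹ * (ρ * ℭ x - A * (x * deriv ℭ x) - A * (c * quadF n ℭ x))) := by ring
  rw [heq, abs_mul, abs_of_pos hD0, abs_mul, abs_mul, abs_of_nonneg (by positivity : 0 ≤ (k ^ 2)⁻¹),
    mul_assoc (|c| * (k ^ 2)⁻¹), mul_div_assoc]
  refine mul_le_mul_of_nonneg_left (mul_le_mul_of_nonneg_left ?_ (by positivity)) hD0.le
  have e1 : |ρ * ℭ x| ≤ 2 / L * (M * P) := by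
    rw [abs_mul, abs_of_nonneg hρ0]; gcongr
  have e2 : |A * (x * deriv ℭ x)| ≤ 1 / L * (M * P) := by
    rw [abs_mul, abs_of_pos hA0]; gcongr
  have e3 : |A * (c * quadF n ℭ x)| ≤ 1 / L * (|c| * (M * P)) := by
    rw [abs_mul, abs_mul, abs_of_pos hA0]; gcongr
  calc |ρ * ℭ x - A * (x * deriv ℭ x) - A * (c * quadF n ℭ x)|
      ≤ |ρ * ℭ x| + |A * (x * deriv ℭ x)| + |A * (c * quadF n ℭ x)| :=
        (abs_sub _ _).trans (add_le_add_left (abs_sub _ _) _)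
    _ ≤ 2 / L * (M * P) + 1 / L * (M * P) + 1 / L * (|c| * (M * P)) := by gcongr
    _ = (3 + |c|) * (M * P) / L := by ring

end Barrier

end RicciNeckpinch

/-! ### Choice of the time threshold. -/

theorem mainTheorem4 (n : ℕ) (hn : 2 ≤ n) (𝔅 ℭ : ℝ → ℝ)
    (h𝔅 : RicciNeckpinch.IsBryantProfile n 𝔅)
    (hℭ : RicciNeckpinch.IsBryantCorrection n 𝔅 ℭ)
    (ε B : ℝ) (hε : 0 < ε) (hB : 0 < B) :
    ∃ tstar : ℝ, 0 < tstar ∧ tstar < 1 ∧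
      ∀ k : ℝ, k ∈ Set.Icc (1 / (2 * ((n : ℝ) - 1))) (2 / ((n : ℝ) - 1)) →
        RicciNeckpinch.IsSubsolutionOn n
          (RicciNeckpinch.innerBarrier 𝔅 ℭ k (1 + ε))
          (RicciNeckpinch.innerRegion B ε tstar) ∧
        RicciNeckpinch.IsSupersolutionOn n
          (RicciNeckpinch.innerBarrier 𝔅 ℭ k (1 - ε))
          (RicciNeckpinch.innerRegion B ε tstar) := by
  have hN : 0 < (n : ℝ) - 1 := by
    have : (2 : ℝ) ≤ n := by exact_mod_cast hn
    linarith
  -- The largest value of `kσ` over the region and all admissible `k`, which makes `M` independent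
  -- of `k`.
  obtain ⟨M, hM, hb⟩ := hℭ.exists_bound hn h𝔅 (2 / ((n : ℝ) - 1) * (3 * (B / Real.sqrt ε)))
  set N := (n : ℝ) - 1 with hNdef
  -- The defect error constant, with `|c| ≤ 1 + ε` and `k⁻² ≤ (2N)²` inserted.
  set Γ := (1 + ε) * (2 * N) ^ 2 * (3 + (1 + ε)) * M with hΓ
  have hΓ0 : 0 < Γ := by positivity
  -- For smaller `t`, `L ≥ 1 + Γ/ε`: this gives `L ≥ 1` and `Γ/L ≤ ε`, so the error cannot exceed
  -- the main term `ε P`.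
  refine ⟨Real.exp (-(1 + Γ / ε)), Real.exp_pos _, by
    rw [Real.exp_lt_one_iff]; have : 0 < Γ / ε := by positivity
    linarith, fun k hk => ?_⟩
  have hk0 : 0 < k := lt_of_lt_of_le (by positivity) hk.1
  have key : ∀ r t, (r, t) ∈ RicciNeckpinch.innerRegion B ε (Real.exp (-(1 + Γ / ε))) →
      0 < r ∧ 0 < t ∧ t < 1 ∧ ∃ D > 0, ∃ P > 0, ∀ c, |c| ≤ 1 + ε →
        |deriv (fun s => RicciNeckpinch.innerBarrier 𝔅 ℭ k c r s) t
          - RicciNeckpinch.opF n (fun y => RicciNeckpinch.innerBarrier 𝔅 ℭ k c y t) r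
          - D * ((1 - c) * P)| ≤ D * (ε * P) := by
    rintro r t ⟨⟨hr, hrB⟩, ht0, ht⟩
    dsimp only at hr hrB ht0 ht
    have hΓε : 0 < Γ / ε := by positivity
    have ht1 : t < 1 := ht.trans (by rw [Real.exp_lt_one_iff]; linarith)
    have hL : 1 + Γ / ε ≤ -Real.log t := by
      have := Real.log_lt_log ht0 ht
      rw [Real.log_exp] at this
      linarith
    have hθ := RicciNeckpinch.theta_pos ht0 ht1
    have hx : 0 < k * (r / RicciNeckpinch.theta t) := by positivity
    have hxX : k * (r / RicciNeckpinch.theta t) ≤ 2 / N * (3 * (B / Real.sqrt ε)) := by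
      gcongr
      · exact hk.2
      · rw [div_le_iff₀ hθ]; exact hrB
    obtain ⟨h1, h2, h3⟩ := hb _ hx hxX
    have hP := h𝔅.neg_mul_deriv_pos hn hx
    refine ⟨hr, ht0, ht1, _, ?_, _, hP, fun c hc => (RicciNeckpinch.abs_defect_le h𝔅 hℭ hk0 hr ht0
      ht1 (by linarith) rfl h1 h2 h3).trans ?_⟩
    · have : 0 < -Real.log t := by linarith
      have : 0 < RicciNeckpinch.thetaRate t := by
        unfold RicciNeckpinch.thetaRate; positivity
      positivity
    set x := k * (r / RicciNeckpinch.theta t)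
    have hL0 : 0 < -Real.log t := by linarith
    have hA : 0 < RicciNeckpinch.thetaRate t := by
      unfold RicciNeckpinch.thetaRate; positivity
    refine mul_le_mul_of_nonneg_left ?_ (by positivity)
    rw [div_le_iff₀ hL0]
    have hk2 : (k ^ 2)⁻¹ ≤ (2 * N) ^ 2 := by
      rw [← inv_pow]
      gcongr
      rw [inv_le_comm₀ hk0 (by positivity), ← one_div]
      exact hk.1
    calc |c| * (k ^ 2)⁻¹ * (3 + |c|) * (M * -(x * deriv 𝔅 x))
        ≤ (1 + ε) * (2 * N) ^ 2 * (3 + (1 + ε)) * (M * -(x * deriv 𝔅 x)) := by gcongr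
      _ = ε * -(x * deriv 𝔅 x) * (Γ / ε) := by rw [hΓ]; field_simp
      _ ≤ ε * -(x * deriv 𝔅 x) * -Real.log t := by gcongr; linarith
  constructor
  · intro r t hrt
    obtain ⟨hr, ht0, ht1, D, hD, P, hP, hdef⟩ := key r t hrt
    refine ⟨RicciNeckpinch.contDiffAt_innerBarrier h𝔅 hℭ hk0 hr ht0 ht1, ?_⟩
    have := (abs_le.1 (hdef (1 + ε) (abs_of_pos (by linarith)).le)).2
    linarith
  · intro r t hrt
    obtain ⟨hr, ht0, ht1, D, hD, P, hP, hdef⟩ := key r t hrt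
    refine ⟨RicciNeckpinch.contDiffAt_innerBarrier h𝔅 hℭ hk0 hr ht0 ht1, ?_⟩
    have := (abs_le.1 (hdef (1 - ε) (abs_le.2 ⟨by linarith, by linarith⟩))).1
    linarith
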